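/- **System.** Consider the control-affine system $\dot x=f(x)+(B+G(x))u$, $y=h(x)+(D+J(x))u$ with state $x\in\mathbb R^n$, input $u\in\mathbb R^m$, output $y\in\mathbb R^p$, where $f(0)=0$, $G(0)=0$, $h(0)=0$, $J(0)=0$, and suppose $B=0$ and $D=0$. Let $\mathcal X\subset\mathbb R^n$ be compact with $\mathcal X=\overline{\mathcal X^\circ}$ and $\mathcal X^\circ$ connected and containing $0$, and let $f,G,h,J$ be of class $C^2$ on $\mathcal X$. Let $Q=Q^\top\in\mathbb R^{p\times p}$, $S\in\mathbb R^{p\times m}$, $R=R^\top\in\mathbb R^{m\times m}$ with $Q\prec0$, $R\succ0$. For $v,x\in\mathbb R^n$ put $$M(v,x)=\begin{bmatrix} v^\top f(x) & \tfrac12 v^\top G(x)-h(x)^\top S & h(x)^\top\\ * & -R-S^\top J(x)-J(x)^\top S & J(x)^\top\\ * & * & Q^{-1}\end{bmatrix}.$$ **Triangulation.** Let $\mathcal T=\{\sigma_i\}_{i=1}^{N}$ be a triangulation of $\mathcal X$: finitely many $n$-simplices $\sigma_i=\mathrm{co}\{x_{i,0},\dots,x_{i,n}\}$ with union $\mathcal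 X$, any two of which intersect in a common face or not at all; if $0\in\sigma_i$ then $x_{i,0}=0$. Let $V$ be a continuous function on $\mathcal X$ that is affine on every $\sigma_i$ (so it is determined by its values at the vertices), and let $\nabla V_i=X_i^{-1}\bar V_i$ be its gradient on $\sigma_i$, where $X_i$ has $j$-th row $(x_{i,j}-x_{i,0})^\top$ and $\bar V_i$ has $j$-th entry $V(x_{i,j})-V(x_{i,0})$, $1\le j\le n$. Put $$c_{i,j}=\begin{cases}\|x_{i,j}-x_{i,0}\|_2\bigl(\max_{1\le k\le n}\|x_{i,k}-x_{i,0}\|_2+\|x_{i,j}-x_{i,0}\|_2\bigr), & 0\in\sigma_i,\\ \max_{0\le\nu\le n}\|x_{i,j}-x_{i,\nu}\|_2^2, & 0\notin\sigma_i.\end{cases}$$ **Constants.** Let $\hat s,l_i\in\mathbb R$ and let $\beta_i,\rho_{i,a},\mu_{i,k},\theta_i$ ($1\le i\le N$, $1\le a\le p$, $1\le k\le m$) satisfy, for all $1\le q,r\le n$ and $\xi\in\sigma_i$, the bounds $|\partial_q\partial_r f^{(b)}(\xi)|\le\beta_i$ for $1\le b\le n$, $|\partial_q\partial_r h^{(a)}(\xi)|\le\rho_{i,a}$,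 $|\partial_q\partial_r G_k^{(b)}(\xi)|\le\mu_{i,k}$ for $1\le b\le n$, and $|\partial_q\partial_r J_k^{(a)}(\xi)|\le\theta_i$ for all $a,k$; here $G_k,J_k$ are the $k$-th columns. Let $\Pi_1\in\mathbb R^{m\times m}$ and $\Pi_2,\Pi_3\in\mathbb R^{p\times p}$ be diagonal and positive definite, and let $\underline\pi_z$ be the smallest diagonal entry of $\Pi_z^{-1}$. Define $$\bar E_{i,j}=\begin{bmatrix}\hat f_{i,j}&*&*&*&*&*&*\\0&\hat R_{i,j}&*&*&*&*&*\\0&0&\hat Q&*&*&*&*\\ \hat s\hat h_{i,j}&0&0&-2\underline\pi_1I&*&*&*\\ l_i\hat G_{i,j}&0&0&0&-4\underline\pi_1I&*&*\\ \hat h_{i,j}&0&0&0&0&-2\Pi_2^{-1}&*\\0&\hat J_{i,j}&0&0&0&0&-2\underline\pi_3I\end{bmatrix}$$ with block sizes $1,m,p,p,m,p,m$ and $\hat f_{i,j}=\frac n2 l_i\beta_ic_{i,j}$, $\hat R_{i,j}=\frac12\bigl(\Pi_1^{-1}+\hat s\,n\sqrt{pm}\,\theta_ic_{i,j}I\bigr)$,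 $\hat Q=\frac12(\Pi_2^{-1}+\Pi_3^{-1})$, $\hat h_{i,j}=n\,c_{i,j}(\rho_{i,1},\dots,\rho_{i,p})^\top$, $\hat G_{i,j}=n\,c_{i,j}(\mu_{i,1},\dots,\mu_{i,m})^\top$, $\hat J_{i,j}=n\sqrt{pm}\,\theta_ic_{i,j}I$. **Theorem.** Suppose that 1. $V(x_{i,j})\ge0$ for all $i,j$; 2. $\|\nabla V_i\|_1\le l_i$ for all $i$; 3. $\|S\|_2\le\hat s$; 4. $\begin{bmatrix}M(\nabla V_i,x_{i,j})&0\\0&0\end{bmatrix}+\bar E_{i,j}\preceq0$ for all $i,j$ with $x_{i,j}\ne0$. Then $V$ satisfies the QSR dissipation inequality on $\mathcal X^\circ$: for every $x\in\mathcal X^\circ$ and every $i$ with $x\in\sigma_i$ one has $M(\nabla V_i,x)\preceq0$; in particular $M(\nabla V(x),x)\preceq0$ at every $x\in\mathcal X^\circ$ at which $V$ is differentiable. -/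

import Mathlib

noncomputable section

namespace QSRDissipativity

open scoped Matrix

/-- `ℝⁿ` with the Euclidean norm. -/
abbrev E (n : ℕ) : Type := EuclideanSpace ℝ (Fin n)

/-- `A ⪯ 0` (in particular `A` is symmetric). -/
def NegSemidef {ι : Type*} [Fintype ι] (A : Matrix ι ι ℝ) : Prop := (-A).PosSemidef

/-- `A ≺ 0` (in particular `A` is symmetric). -/
def NegDef {ι : Type*} [Fintype ι] (A : Matrix ι ι ℝ) : Prop := (-A).PosDef

open scoped Matrix.Norms.L2Operator in
/-- The spectral norm `‖A‖₂` of a rectangular real matrix. -/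
def spectralNorm {p m : ℕ} (A : Matrix (Fin p) (Fin m) ℝ) : ℝ := ‖A‖

/-- The control-affine system `x' = f(x) + (B + G(x)) u`, `y = h(x) + (D + J(x)) u`, normalised by
`f(0) = 0`, `G(0) = 0`, `h(0) = 0`, `J(0) = 0`. -/
structure ControlAffineSystem (n m p : ℕ) where
  f : E n → E n
  G : E n → Matrix (Fin n) (Fin m) ℝ
  h : E n → E p
  J : E n → Matrix (Fin p) (Fin m) ℝ
  B : Matrix (Fin n) (Fin m) ℝ
  D : Matrix (Fin p) (Fin m) ℝ
  f_zero : f 0 = 0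
  G_zero : G 0 = 0
  h_zero : h 0 = 0
  J_zero : J 0 = 0

namespace ControlAffineSystem

variable {n m p : ℕ}

/-- `Ḡ(x) = B + G(x)`. -/
def Gbar (sys : ControlAffineSystem n m p) (x : E n) : Matrix (Fin n) (Fin m) ℝ :=
  sys.B + sys.G x

/-- `J̄(x) = D + J(x)`. -/
def Jbar (sys : ControlAffineSystem n m p) (x : E n) : Matrix (Fin p) (Fin m) ℝ :=
  sys.D + sys.J x

/-- All of `f, G, h, J` are of class `C²` on `X` (matrix-valued maps entrywise). -/
def IsC2On (sys : ControlAffineSystem n m p) (X : Set (E n)) : Prop :=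
  ContDiffOn ℝ 2 sys.f X ∧
  (∀ a k, ContDiffOn ℝ 2 (fun x => sys.G x a k) X) ∧
  ContDiffOn ℝ 2 sys.h X ∧
  (∀ a k, ContDiffOn ℝ 2 (fun x => sys.J x a k) X)

/-- The matrix `M(x)` of the QSR dissipation inequality, with `v` in the place of `∇V`:
```
[ vᵀ f(x)   ½ vᵀ Ḡ(x) - h(x)ᵀ S          h(x)ᵀ  ]
[   *       -R - Sᵀ J̄(x) - J̄(x)ᵀ S     J̄(x)ᵀ ]
[   *                *                    Q⁻¹   ]
``` -/
def qsrMatrix (sys : ControlAffineSystem n m p) (Q : Matrix (Fin p) (Fin p) ℝ)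
    (S : Matrix (Fin p) (Fin m) ℝ) (R : Matrix (Fin m) (Fin m) ℝ) (v : E n) (x : E n) :
    Matrix (Unit ⊕ Fin m ⊕ Fin p) (Unit ⊕ Fin m ⊕ Fin p) ℝ :=
  let b : Fin m → ℝ := (1 / 2 : ℝ) • (v.ofLp ᵥ* sys.Gbar x) - (sys.h x).ofLp ᵥ* S
  Matrix.fromBlocks
    (Matrix.of fun _ _ => v.ofLp ⬝ᵥ (sys.f x).ofLp)
    (Matrix.fromCols (Matrix.replicateRow Unit b) (Matrix.replicateRow Unit (sys.h x).ofLp))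
    (Matrix.fromRows (Matrix.replicateCol Unit b) (Matrix.replicateCol Unit (sys.h x).ofLp))
    (Matrix.fromBlocks
      (-R - Sᵀ * sys.Jbar x - (sys.Jbar x)ᵀ * S) (sys.Jbar x)ᵀ
      (sys.Jbar x) Q⁻¹)

end ControlAffineSystem

variable {n : ℕ}

/-- The class of regions: compact sets which are the closure of their interior, the interior being
connected and containing the origin. -/
structure IsRegion (X : Set (E n)) : Prop where
  isCompact : IsCompact X
  isConnected_interior : IsConnected (interior X)
  zero_mem_interior : (0 : E n) ∈ interior X
  closure_interior : closure (interior X) = X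

/-- A triangulation of `X`: finitely many `n`-simplices with union `X`, any two of which meet in a
common face (the convex hull of their common vertices) or not at all. If a simplex contains the
origin, then the origin is its vertex number `0`. -/
structure Triangulation (X : Set (E n)) where
  N : ℕ
  simplex : Fin N → Affine.Simplex ℝ (E n) n
  iUnion_eq : ⋃ i, convexHull ℝ (Set.range (simplex i).points) = X
  inter_eq : ∀ i k,
    convexHull ℝ (Set.range (simplex i).points) ∩ convexHull ℝ (Set.range (simplex k).points) =
      convexHull ℝ (Set.range (simplex i).points ∩ Set.range (simplex k).points)
  origin : ∀ i, (0 : E n) ∈ convexHull ℝ (Set.range (simplex i).points) →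
    (simplex i).points 0 = 0

namespace Triangulation

variable {X : Set (E n)}

/-- The vertex `x_{i,j}`. -/
def vertex (T : Triangulation X) (i : Fin T.N) (j : Fin (n + 1)) : E n := (T.simplex i).points j

/-- The closed simplex `σ_i`. -/
def cell (T : Triangulation X) (i : Fin T.N) : Set (E n) :=
  convexHull ℝ (Set.range (T.vertex i))

/-- `V` is continuous on `X` and affine on each simplex; on `X` such a `V` is determined by its
values at the vertices. -/
def IsCPA (T : Triangulation X) (V : E n → ℝ) : Prop :=
  ContinuousOn V X ∧ ∀ i, ∃ g : E n →ᵃ[ℝ] ℝ, Set.EqOn V g (T.cell i)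

/-- The gradient `∇V_i = X_i⁻¹ W_i` of the affine interpolation of `V` on `σ_i`; here `X_i` has
`j`-th row `x_{i,j} - x_{i,0}` and `W_i` has `j`-th entry `V(x_{i,j}) - V(x_{i,0})`. -/
def grad (T : Triangulation X) (V : E n → ℝ) (i : Fin T.N) : E n :=
  WithLp.toLp 2
    ((Matrix.of fun j k : Fin n => T.vertex i j.succ k - T.vertex i 0 k)⁻¹ *ᵥ
      fun j => V (T.vertex i j.succ) - V (T.vertex i 0))

open Classical in
/-- The simplex constants: `c_{i,j} = ‖x_j - x_0‖ (max_{1 ≤ k ≤ n} ‖x_k - x_0‖ + ‖x_j - x_0‖)` if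
`0 ∈ σ_i`, and `c_{i,j} = max_{0 ≤ ν ≤ n} ‖x_j - x_ν‖²` otherwise. -/
def c (T : Triangulation X) (i : Fin T.N) (j : Fin (n + 1)) : ℝ :=
  if (0 : E n) ∈ T.cell i then
    ‖T.vertex i j - T.vertex i 0‖ *
      ((⨆ k : Fin n, ‖T.vertex i k.succ - T.vertex i 0‖) + ‖T.vertex i j - T.vertex i 0‖)
  else ⨆ ν : Fin (n + 1), ‖T.vertex i j - T.vertex i ν‖ ^ 2

end Triangulation

/-- The second partial derivative `∂²φ / ∂x^(q) ∂x^(r)` at `ξ ∈ X`, taken within `X` (at interior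
points of `X` this is the usual one, at boundary points it is the one-sided one). -/
def secondPartial (X : Set (E n)) (φ : E n → ℝ) (q r : Fin n) (ξ : E n) : ℝ :=
  iteratedFDerivWithin ℝ 2 φ X ξ ![EuclideanSpace.single q 1, EuclideanSpace.single r 1]

/-- `b` bounds all second partial derivatives of `φ` on `σ` in absolute value. -/
def HessianBound (X σ : Set (E n)) (φ : E n → ℝ) (b : ℝ) : Prop :=
  ∀ q r : Fin n, ∀ ξ ∈ σ, |secondPartial X φ q r ξ| ≤ b

/-- The smallest diagonal entry of `Π⁻¹`. -/
def minDiagInv {m : ℕ} (P : Matrix (Fin m) (Fin m) ℝ) : ℝ := ⨅ k, P⁻¹ k k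

/-- `M` bordered by zero blocks. -/
def padZero {ι κ : Type*} (M : Matrix ι ι ℝ) : Matrix (ι ⊕ κ) (ι ⊕ κ) ℝ :=
  Matrix.fromBlocks M 0 0 0

/-- The error matrix `Ē`, with block sizes `1, m, p, p, m, p, m`:
```
[ f̂                                                         ]
[ 0      R̂                                                  ]
[ 0      0    Q̂                                             ]
[ ŝ ĥ    0    0   -2 π₁ I                                    ]
[ l Ĝ    0    0      0     -4 π₁ I                           ]
[ ĥ      0    0      0        0     -2 Π₂⁻¹                  ]
[ 0      Ĵ    0      0        0        0      -2 π₃ I        ]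
```
completed symmetrically, where `π_z` is the smallest diagonal entry of `Π_z⁻¹` and
`f̂ = (n/2) l β c`, `R̂ = ½ (Π₁⁻¹ + ŝ n √(pm) θ c I)`, `Q̂ = ½ (Π₂⁻¹ + Π₃⁻¹)`,
`ĥ = n c ρ`, `Ĝ = n c μ`, `Ĵ = n √(pm) θ c I`. -/
def errorMatrix (n : ℕ) {m p : ℕ} (P₁ : Matrix (Fin m) (Fin m) ℝ)
    (P₂ P₃ : Matrix (Fin p) (Fin p) ℝ) (s l β θ : ℝ) (ρ : Fin p → ℝ) (μ : Fin m → ℝ) (c : ℝ) :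
    Matrix ((Unit ⊕ Fin m ⊕ Fin p) ⊕ (Fin p ⊕ Fin m ⊕ Fin p ⊕ Fin m))
      ((Unit ⊕ Fin m ⊕ Fin p) ⊕ (Fin p ⊕ Fin m ⊕ Fin p ⊕ Fin m)) ℝ :=
  let fhat : ℝ := (n : ℝ) / 2 * l * β * c
  let Jhat : Matrix (Fin m) (Fin m) ℝ := ((n : ℝ) * √((p : ℝ) * m) * θ * c) • 1
  let Rhat : Matrix (Fin m) (Fin m) ℝ :=
    (1 / 2 : ℝ) • (P₁⁻¹ + (s * n * √((p : ℝ) * m) * θ * c) • 1)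
  let Qhat : Matrix (Fin p) (Fin p) ℝ := (1 / 2 : ℝ) • (P₂⁻¹ + P₃⁻¹)
  let hhat : Fin p → ℝ := fun a => n * (ρ a * c)
  let Ghat : Fin m → ℝ := fun k => n * (μ k * c)
  -- upper left corner
  let A : Matrix (Unit ⊕ Fin m ⊕ Fin p) (Unit ⊕ Fin m ⊕ Fin p) ℝ :=
    Matrix.fromBlocks (Matrix.of fun _ _ => fhat) 0 0 (Matrix.fromBlocks Rhat 0 0 Qhat)
  -- lower left corner, by its columns
  let C : Matrix (Fin p ⊕ Fin m ⊕ Fin p ⊕ Fin m) (Unit ⊕ Fin m ⊕ Fin p) ℝ :=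
    Matrix.fromCols
      (Matrix.replicateCol Unit (Sum.elim (s • hhat) (Sum.elim (l • Ghat) (Sum.elim hhat 0))))
      (Matrix.fromCols
        (Matrix.fromRows 0 (Matrix.fromRows 0 (Matrix.fromRows 0 Jhat)))
        0)
  -- lower right corner
  let F : Matrix (Fin p ⊕ Fin m ⊕ Fin p ⊕ Fin m) (Fin p ⊕ Fin m ⊕ Fin p ⊕ Fin m) ℝ :=
    Matrix.fromBlocks ((-2 * minDiagInv P₁) • 1) 0 0
      (Matrix.fromBlocks ((-4 * minDiagInv P₁) • 1) 0 0
        (Matrix.fromBlocks ((-2 : ℝ) • P₂⁻¹) 0 0 ((-2 * minDiagInv P₃) • 1)))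
  Matrix.fromBlocks A Cᵀ C F

end QSRDissipativity

end

noncomputable section

namespace QSRDissipativity

open scoped Matrix

variable {n m p : ℕ}

/-! For a fixed gradient `v` and test vector `(a, y, z)`, the quadratic form of `M(v, x)` is affine
in the values of `f, G, h, J` at `x` (`qsrMatrix_quadForm`). Write `x = ∑ w_j x_{i,j}` as a convex
combination of vertices. The form at `x` then differs from the `w`-average of its vertex values only
by interpolation errors of scalar C² functions.

Such an error is controlled by Jensen's inequality: if all second partials of `φ` are at most `b`,
both `±φ + (n b / 2)‖·‖²` are convex (`abs_sub_sum_le`). The variance of the vertices that appears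
is at most `½ ∑ w_j c_{i,j}`, so each entry errs by at most `(n b / 4) ∑ w_j c_{i,j}`. Hence the
form at `x` is at most a `w`-average of vertex terms "form plus `c_{i,j}` times `errorBound`"
(`qsrMatrix_quadForm_le`).

Each vertex term is nonpositive. At a nonzero vertex, evaluating the LMI at one extension of `(a, y,
z)` produces exactly the required mixed terms (`quadForm_add_errorBound_nonpos`). At the origin
`c_{i,j} = 0` and `M(v, 0) = diag(0, -R, Q⁻¹)`. -/

/-! ### Quadratic forms of the block matrices -/

theorem sumElim_dotProduct_sumElim_mulVec_fromBlocks {ι κ : Type*} [Fintype ι] [Fintype κ]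
    (A : Matrix ι ι ℝ) (B : Matrix ι κ ℝ) (C : Matrix κ ι ℝ) (D : Matrix κ κ ℝ)
    (u : ι → ℝ) (w : κ → ℝ) :
    Sum.elim u w ⬝ᵥ (Matrix.fromBlocks A B C D *ᵥ Sum.elim u w) =
      u ⬝ᵥ (A *ᵥ u) + u ⬝ᵥ (B *ᵥ w) + w ⬝ᵥ (C *ᵥ u) + w ⬝ᵥ (D *ᵥ w) := by
  simp only [Matrix.fromBlocks_mulVec, Sum.elim_comp_inl, Sum.elim_comp_inr,
    sumElim_dotProduct_sumElim, dotProduct_add]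
  ring

theorem const_dotProduct_replicateRow_mulVec {ι : Type*} [Fintype ι] (b y : ι → ℝ) (a : ℝ) :
    (fun _ : Unit => a) ⬝ᵥ (Matrix.replicateRow Unit b *ᵥ y) = a * (b ⬝ᵥ y) := by
  simp [dotProduct, Matrix.mulVec]

theorem dotProduct_replicateCol_mulVec_const {ι : Type*} [Fintype ι] (b y : ι → ℝ) (a : ℝ) :
    y ⬝ᵥ (Matrix.replicateCol Unit b *ᵥ (fun _ : Unit => a)) = a * (b ⬝ᵥ y) := by
  simp only [dotProduct, Matrix.mulVec, Finset.mul_sum, Matrix.replicateCol_apply,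
    Finset.univ_unique, Finset.sum_singleton]
  exact Finset.sum_congr rfl fun _ _ => by ring

theorem qsrMatrix_quadForm (sys : ControlAffineSystem n m p) (hB : sys.B = 0) (hD : sys.D = 0)
    (Q : Matrix (Fin p) (Fin p) ℝ) (S : Matrix (Fin p) (Fin m) ℝ) (R : Matrix (Fin m) (Fin m) ℝ)
    (v x : E n) (a : ℝ) (y : Fin m → ℝ) (z : Fin p → ℝ) :
    (Sum.elim (fun _ => a) (Sum.elim y z)) ⬝ᵥ
      (sys.qsrMatrix Q S R v x *ᵥ (Sum.elim (fun _ => a) (Sum.elim y z))) =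
    a ^ 2 * (v.ofLp ⬝ᵥ (sys.f x).ofLp) + a * (v.ofLp ⬝ᵥ (sys.G x *ᵥ y))
      - 2 * a * ((sys.h x).ofLp ⬝ᵥ (S *ᵥ y)) + 2 * a * ((sys.h x).ofLp ⬝ᵥ z)
      - y ⬝ᵥ (R *ᵥ y) - 2 * ((S *ᵥ y) ⬝ᵥ (sys.J x *ᵥ y)) + 2 * (z ⬝ᵥ (sys.J x *ᵥ y))
      + z ⬝ᵥ (Q⁻¹ *ᵥ z) := by
  unfold ControlAffineSystem.qsrMatrix ControlAffineSystem.Gbar ControlAffineSystem.Jbar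
  simp only [hB, hD, zero_add, sumElim_dotProduct_sumElim_mulVec_fromBlocks,
    Matrix.fromCols_mulVec_sumElim, Matrix.fromRows_mulVec, sumElim_dotProduct_sumElim,
    const_dotProduct_replicateRow_mulVec, dotProduct_replicateCol_mulVec_const, dotProduct_add,
    Matrix.sub_mulVec, Matrix.neg_mulVec, dotProduct_sub, dotProduct_neg, sub_dotProduct,
    smul_dotProduct, ← Matrix.dotProduct_mulVec, ← Matrix.mulVec_mulVec]
  have h1 : y ⬝ᵥ (Sᵀ *ᵥ (sys.J x *ᵥ y)) = (S *ᵥ y) ⬝ᵥ (sys.J x *ᵥ y) := by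
    rw [Matrix.dotProduct_mulVec, Matrix.vecMul_transpose]
  have h2 : y ⬝ᵥ ((sys.J x)ᵀ *ᵥ (S *ᵥ y)) = (S *ᵥ y) ⬝ᵥ (sys.J x *ᵥ y) := by
    rw [Matrix.dotProduct_mulVec, Matrix.vecMul_transpose, dotProduct_comm]
  have h3 : y ⬝ᵥ ((sys.J x)ᵀ *ᵥ z) = z ⬝ᵥ (sys.J x *ᵥ y) := by
    rw [Matrix.dotProduct_mulVec, Matrix.vecMul_transpose, dotProduct_comm]
  have h4 : (fun _ : Unit => a) ⬝ᵥ ((Matrix.of fun _ _ : Unit => v.ofLp ⬝ᵥ (sys.f x).ofLp) *ᵥ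
      fun _ => a) = a ^ 2 * (v.ofLp ⬝ᵥ (sys.f x).ofLp) := by
    simp [dotProduct, Matrix.mulVec]; ring
  rw [h1, h2, h3, h4]
  simp only [smul_eq_mul]
  ring

theorem qsrMatrix_isSymm (sys : ControlAffineSystem n m p)
    {Q : Matrix (Fin p) (Fin p) ℝ} (S : Matrix (Fin p) (Fin m) ℝ) {R : Matrix (Fin m) (Fin m) ℝ}
    (hQ : Q.IsSymm) (hR : R.IsSymm) (v x : E n) : (sys.qsrMatrix Q S R v x).IsSymm := by
  unfold ControlAffineSystem.qsrMatrix
  refine Matrix.IsSymm.fromBlocks ?_ ?_ (Matrix.IsSymm.fromBlocks ?_ ?_ ?_)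
  · ext; rfl
  · ext i j
    rcases i with i | i <;> simp [Matrix.transpose_apply]
  · simp only [Matrix.IsSymm, Matrix.transpose_sub, Matrix.transpose_neg, Matrix.transpose_mul,
      Matrix.transpose_transpose, hR.eq]
    abel
  · simp
  · rw [Matrix.IsSymm, Matrix.transpose_nonsing_inv, hQ.eq]

theorem errorMatrix_quadForm (n : ℕ) (P₁ : Matrix (Fin m) (Fin m) ℝ)
    (P₂ P₃ : Matrix (Fin p) (Fin p) ℝ) (s l β θ : ℝ) (ρ : Fin p → ℝ) (μ : Fin m → ℝ) (c : ℝ)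
    (a : ℝ) (y : Fin m → ℝ) (z w₁ : Fin p → ℝ) (w₂ : Fin m → ℝ) (w₃ : Fin p → ℝ)
    (w₄ : Fin m → ℝ) :
    (Sum.elim (Sum.elim (fun _ => a) (Sum.elim y z)) (Sum.elim w₁ (Sum.elim w₂ (Sum.elim w₃ w₄))))
      ⬝ᵥ (errorMatrix n P₁ P₂ P₃ s l β θ ρ μ c *ᵥ
      (Sum.elim (Sum.elim (fun _ => a) (Sum.elim y z))
        (Sum.elim w₁ (Sum.elim w₂ (Sum.elim w₃ w₄))))) =
    a ^ 2 * (n / 2 * l * β * c)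
      + 1 / 2 * (y ⬝ᵥ (P₁⁻¹ *ᵥ y)) + 1 / 2 * (s * n * √((p : ℝ) * m) * θ * c) * (y ⬝ᵥ y)
      + 1 / 2 * (z ⬝ᵥ (P₂⁻¹ *ᵥ z)) + 1 / 2 * (z ⬝ᵥ (P₃⁻¹ *ᵥ z))
      + 2 * a * s * (n * c) * (ρ ⬝ᵥ w₁) + 2 * a * l * (n * c) * (μ ⬝ᵥ w₂)
      + 2 * a * (n * c) * (ρ ⬝ᵥ w₃) + 2 * (n * √((p : ℝ) * m) * θ * c) * (w₄ ⬝ᵥ y)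
      - 2 * minDiagInv P₁ * (w₁ ⬝ᵥ w₁) - 4 * minDiagInv P₁ * (w₂ ⬝ᵥ w₂)
      - 2 * (w₃ ⬝ᵥ (P₂⁻¹ *ᵥ w₃)) - 2 * minDiagInv P₃ * (w₄ ⬝ᵥ w₄) := by
  have hρ : (fun i => (n : ℝ) * (ρ i * c)) = (n * c : ℝ) • ρ := by
    ext i; simp only [Pi.smul_apply, smul_eq_mul]; ring
  have hμ : (fun i => (n : ℝ) * (μ i * c)) = (n * c : ℝ) • μ := by
    ext i; simp only [Pi.smul_apply, smul_eq_mul]; ring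
  have h4 (t : ℝ) : (fun _ : Unit => a) ⬝ᵥ ((Matrix.of fun _ _ : Unit => t) *ᵥ
      fun _ => a) = a ^ 2 * t := by
    simp [dotProduct, Matrix.mulVec]; ring
  unfold errorMatrix
  rw [hρ, hμ]
  simp only [sumElim_dotProduct_sumElim_mulVec_fromBlocks, Matrix.transpose_fromCols,
    Matrix.transpose_fromRows, Matrix.transpose_replicateCol,
    Matrix.fromCols_mulVec_sumElim, Matrix.fromRows_mulVec, sumElim_dotProduct_sumElim,
    const_dotProduct_replicateRow_mulVec, dotProduct_replicateCol_mulVec_const, dotProduct_add,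
    smul_dotProduct, h4, Matrix.smul_mulVec, Matrix.add_mulVec, Matrix.one_mulVec,
    Matrix.zero_mulVec, dotProduct_zero, zero_dotProduct, dotProduct_smul, smul_eq_mul,
    Matrix.transpose_zero, Matrix.transpose_smul, Matrix.transpose_one]
  rw [dotProduct_comm y w₄]
  ring

/-! ### From the LMI at a vertex to a scalar inequality -/

theorem exists_sign_mul_eq_abs (a : ℝ) : ∃ e : ℝ, e * a = |a| ∧ e ^ 2 = 1 := by
  rcases le_total 0 a with h | h
  · exact ⟨1, by rw [abs_of_nonneg h, one_mul], by norm_num⟩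
  · exact ⟨-1, by rw [abs_of_nonpos h, neg_one_mul], by norm_num⟩

theorem sum_abs_sq_le_card_mul_dotProduct {ι : Type*} [Fintype ι] (y : ι → ℝ) :
    (∑ k, |y k|) ^ 2 ≤ Fintype.card ι * (y ⬝ᵥ y) := by
  refine (sq_sum_le_card_mul_sum_sq (s := Finset.univ) (f := fun k => |y k|)).trans (le_of_eq ?_)
  simp [dotProduct, sq]

open scoped Matrix.Norms.L2Operator in
theorem spectralNorm_nonneg (S : Matrix (Fin p) (Fin m) ℝ) : 0 ≤ spectralNorm S :=
  norm_nonneg S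

theorem mulVec_dotProduct_self_le {S : Matrix (Fin p) (Fin m) ℝ} {s : ℝ} (hs : spectralNorm S ≤ s)
    (y : Fin m → ℝ) : (S *ᵥ y) ⬝ᵥ (S *ᵥ y) ≤ s ^ 2 * (y ⬝ᵥ y) := by
  have h := Matrix.l2_opNorm_mulVec S (WithLp.toLp 2 y)
  have h' := h.trans (mul_le_mul_of_nonneg_right hs (norm_nonneg _))
  have h2 := pow_le_pow_left₀ (norm_nonneg _) h' 2
  rw [mul_pow, EuclideanSpace.real_norm_sq_eq, EuclideanSpace.real_norm_sq_eq] at h2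
  simpa [dotProduct, sq] using h2

theorem exists_inv_eq_diagonal {P : Matrix (Fin m) (Fin m) ℝ} (hP : P.IsDiag ∧ P.PosDef) :
    ∃ d : Fin m → ℝ, P⁻¹ = Matrix.diagonal d ∧ ∀ k, 0 < d k := by
  obtain ⟨d, rfl⟩ : ∃ d, P = Matrix.diagonal d := ⟨P.diag, hP.1.diagonal_diag.symm⟩
  have hd : ∀ k, 0 < d k := Matrix.posDef_diagonal_iff.1 hP.2
  refine ⟨fun k => (d k)⁻¹, Matrix.inv_eq_left_inv ?_, fun k => inv_pos.2 (hd k)⟩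
  rw [Matrix.diagonal_mul_diagonal, ← Matrix.diagonal_one]
  exact congrArg _ (funext fun k => inv_mul_cancel₀ (hd k).ne')

theorem dotProduct_diagonal_mulVec {ι : Type*} [Fintype ι] [DecidableEq ι] (d y : ι → ℝ) :
    y ⬝ᵥ (Matrix.diagonal d *ᵥ y) = ∑ k, d k * y k ^ 2 := by
  simp only [dotProduct, Matrix.mulVec_diagonal]
  exact Finset.sum_congr rfl fun _ _ => by ring

theorem minDiagInv_nonneg {P : Matrix (Fin m) (Fin m) ℝ} (hP : P.IsDiag ∧ P.PosDef) :
    0 ≤ minDiagInv P := by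
  obtain ⟨d, hd, hpos⟩ := exists_inv_eq_diagonal hP
  refine Real.iInf_nonneg fun k => ?_
  rw [hd, Matrix.diagonal_apply_eq]
  exact (hpos k).le

theorem minDiagInv_mul_le {P : Matrix (Fin m) (Fin m) ℝ} (hP : P.IsDiag ∧ P.PosDef)
    (y : Fin m → ℝ) : minDiagInv P * (y ⬝ᵥ y) ≤ y ⬝ᵥ (P⁻¹ *ᵥ y) := by
  obtain ⟨d, hd, -⟩ := exists_inv_eq_diagonal hP
  have h : ∀ k, minDiagInv P ≤ d k := fun k => by
    have := ciInf_le (Set.finite_range fun k => P⁻¹ k k).bddBelow k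
    simpa only [hd, Matrix.diagonal_apply_eq, minDiagInv] using this
  rw [hd, dotProduct_diagonal_mulVec, dotProduct, Finset.mul_sum]
  refine Finset.sum_le_sum fun k _ => ?_
  rw [← sq]
  exact mul_le_mul_of_nonneg_right (h k) (sq_nonneg _)

/-- A diagonal form sees only the squares of the entries, so replacing `z` by a multiple of its
entrywise absolute value merely rescales the form. -/
theorem dotProduct_inv_mulVec_of_sq_eq {P : Matrix (Fin m) (Fin m) ℝ} (hP : P.IsDiag ∧ P.PosDef)
    {w z : Fin m → ℝ} {t : ℝ} (h : ∀ k, w k ^ 2 = t * z k ^ 2) :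
    w ⬝ᵥ (P⁻¹ *ᵥ w) = t * (z ⬝ᵥ (P⁻¹ *ᵥ z)) := by
  obtain ⟨d, hd, -⟩ := exists_inv_eq_diagonal hP
  rw [hd, dotProduct_diagonal_mulVec, dotProduct_diagonal_mulVec, Finset.mul_sum]
  exact Finset.sum_congr rfl fun k _ => by rw [h k]; ring

/-- The bound on the interpolation error of the quadratic form of `qsrMatrix`, per unit of the
simplex constant. -/
def errorBound (n : ℕ) {m p : ℕ} (S : Matrix (Fin p) (Fin m) ℝ) (l β θ : ℝ) (ρ : Fin p → ℝ)
    (μ : Fin m → ℝ) (a : ℝ) (y : Fin m → ℝ) (z : Fin p → ℝ) : ℝ :=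
  n / 4 * (a ^ 2 * (l * β) + |a| * (l * ∑ k, μ k * |y k|)
    + 2 * |a| * (∑ b, ρ b * |(S *ᵥ y) b|) + 2 * |a| * (∑ b, ρ b * |z b|)
    + 2 * (θ * ((∑ b, |(S *ᵥ y) b|) * ∑ k, |y k|))
    + 2 * (θ * ((∑ b, |z b|) * ∑ k, |y k|)))

/-- The four border components of the test vector are chosen so that the mixed terms of the LMI
reproduce the `h`, `G` and `J` terms of `errorBound`. Their quadratic cost is absorbed by the halves
of `Π_z⁻¹` on the diagonal. The remaining `SᵀJ` term is paid for by the `θ` part of `R̂`. The sign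
of `θ` is known only when `J` has entries; otherwise the terms with `θ` vanish. -/
theorem quadForm_add_errorBound_nonpos
    (M : Matrix (Unit ⊕ Fin m ⊕ Fin p) (Unit ⊕ Fin m ⊕ Fin p) ℝ) {S : Matrix (Fin p) (Fin m) ℝ}
    {P₁ : Matrix (Fin m) (Fin m) ℝ} {P₂ P₃ : Matrix (Fin p) (Fin p) ℝ}
    (hP₁ : P₁.IsDiag ∧ P₁.PosDef) (hP₂ : P₂.IsDiag ∧ P₂.PosDef) (hP₃ : P₃.IsDiag ∧ P₃.PosDef)
    {s l β θ c : ℝ} {ρ : Fin p → ℝ} {μ : Fin m → ℝ} (hs : spectralNorm S ≤ s) (hl : 0 ≤ l)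
    (hβ : 0 ≤ β) (hθ : 0 < p → 0 < m → 0 ≤ θ) (hc : 0 ≤ c)
    (hM : NegSemidef (padZero M + errorMatrix n P₁ P₂ P₃ s l β θ ρ μ c))
    (a : ℝ) (y : Fin m → ℝ) (z : Fin p → ℝ) :
    (Sum.elim (fun _ => a) (Sum.elim y z)) ⬝ᵥ (M *ᵥ (Sum.elim (fun _ => a) (Sum.elim y z)))
      + c * errorBound n S l β θ ρ μ a y z ≤ 0 := by
  have hs0 : 0 ≤ s := (spectralNorm_nonneg S).trans hs
  obtain ⟨e, hea, he⟩ := exists_sign_mul_eq_abs a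
  choose σ hσy hσ using fun k => exists_sign_mul_eq_abs (y k)
  set N : ℝ := √((p : ℝ) * m) with hN
  have hN0 : 0 ≤ N := Real.sqrt_nonneg _
  have hN2 : N ^ 2 = p * m := Real.sq_sqrt (by positivity)
  have hy0 : 0 ≤ y ⬝ᵥ y := dotProduct_self_star_nonneg y
  have hz0 : 0 ≤ z ⬝ᵥ z := dotProduct_self_star_nonneg z
  have hSy := mulVec_dotProduct_self_le hs y
  have hSy0 : 0 ≤ (S *ᵥ y) ⬝ᵥ (S *ᵥ y) := dotProduct_self_star_nonneg (S *ᵥ y)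
  have hy1 := sum_abs_sq_le_card_mul_dotProduct y
  have hz1 := sum_abs_sq_le_card_mul_dotProduct z
  have hSy1 := sum_abs_sq_le_card_mul_dotProduct (S *ᵥ y)
  rw [Fintype.card_fin] at hy1 hz1 hSy1
  set y1 : ℝ := ∑ k, |y k| with hy1_def
  set z1 : ℝ := ∑ b, |z b| with hz1_def
  set q1 : ℝ := ∑ b, |(S *ᵥ y) b| with hq1_def
  have hy10 : 0 ≤ y1 := Finset.sum_nonneg fun _ _ => abs_nonneg _
  have hz10 : 0 ≤ z1 := Finset.sum_nonneg fun _ _ => abs_nonneg _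
  have hq10 : 0 ≤ q1 := Finset.sum_nonneg fun _ _ => abs_nonneg _
  set t : ℝ := z1 / N with ht
  -- The sign `e` turns `a` into `|a|` and `σ` turns `y` into `|y|`; the factors 1/4 and 1/8 match
  -- the coefficients of `errorBound` exactly.
  have h := hM.dotProduct_mulVec_nonneg
    (Sum.elim (Sum.elim (fun _ => a) (Sum.elim y z))
      (Sum.elim (fun b => e / 4 * (|(S *ᵥ y) b| / s)) (Sum.elim (fun k => e / 8 * |y k|)
        (Sum.elim (fun b => e / 4 * |z b|) (fun k => t / 4 * σ k)))))
  rw [star_trivial, Matrix.neg_mulVec, dotProduct_neg, Matrix.add_mulVec, dotProduct_add,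
    errorMatrix_quadForm, padZero, sumElim_dotProduct_sumElim_mulVec_fromBlocks] at h
  simp only [Matrix.zero_mulVec, dotProduct_zero, add_zero] at h
  set qM := (Sum.elim (fun _ => a) (Sum.elim y z)) ⬝ᵥ
    (M *ᵥ (Sum.elim (fun _ => a) (Sum.elim y z)))
  -- the mixed terms
  have e1 : a * s * (ρ ⬝ᵥ fun b => e / 4 * (|(S *ᵥ y) b| / s)) =
      |a| / 4 * ∑ b, ρ b * |(S *ᵥ y) b| := by
    -- For `s = 0` the norm bound forces `S y = 0`, so the division by zero is harmless.
    rcases hs0.eq_or_lt' with h0 | h0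
    · have hz : S *ᵥ y = 0 := by
        rw [h0] at hSy
        exact dotProduct_self_eq_zero.1 (le_antisymm (by simpa using hSy) hSy0)
      simp [h0, hz]
    · rw [← hea, dotProduct, Finset.mul_sum, Finset.mul_sum]
      exact Finset.sum_congr rfl fun _ _ => by field_simp
  have e2 : a * (μ ⬝ᵥ fun k => e / 8 * |y k|) = |a| / 8 * ∑ k, μ k * |y k| := by
    rw [← hea, dotProduct, Finset.mul_sum, Finset.mul_sum]
    exact Finset.sum_congr rfl fun _ _ => by ring
  have e3 : a * (ρ ⬝ᵥ fun b => e / 4 * |z b|) = |a| / 4 * ∑ b, ρ b * |z b| := by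
    rw [← hea, dotProduct, Finset.mul_sum, Finset.mul_sum]
    exact Finset.sum_congr rfl fun _ _ => by ring
  have e4 : N * ((fun k => t / 4 * σ k) ⬝ᵥ y) = z1 * y1 / 4 := by
    have h1 : ((fun k => t / 4 * σ k) ⬝ᵥ y) = t / 4 * y1 := by
      rw [dotProduct, hy1_def, Finset.mul_sum]
      exact Finset.sum_congr rfl fun k _ => by rw [mul_assoc, hσy]
    rw [h1, ht]
    -- For `N = 0` the left side is zero, and `z1 * y1` vanishes by Cauchy–Schwarz.
    rcases hN0.eq_or_lt' with h0 | h0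
    · have h2 : (z1 * y1) ^ 2 ≤ 0 := by
        calc (z1 * y1) ^ 2 = z1 ^ 2 * y1 ^ 2 := mul_pow _ _ _
          _ ≤ (p * (z ⬝ᵥ z)) * (m * (y ⬝ᵥ y)) :=
            mul_le_mul hz1 hy1 (sq_nonneg _) (by positivity)
          _ = N ^ 2 * ((z ⬝ᵥ z) * (y ⬝ᵥ y)) := by rw [hN2]; ring
          _ = 0 := by rw [h0]; ring
      rw [pow_eq_zero_iff two_ne_zero |>.1 (le_antisymm h2 (sq_nonneg _)), h0]
      ring
    · field_simp
  -- the quadratic terms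
  have f1 : ((fun b => e / 4 * (|(S *ᵥ y) b| / s)) ⬝ᵥ fun b => e / 4 * (|(S *ᵥ y) b| / s)) ≤
      1 / 16 * (y ⬝ᵥ y) := by
    have h1 : ((fun b => e / 4 * (|(S *ᵥ y) b| / s)) ⬝ᵥ fun b => e / 4 * (|(S *ᵥ y) b| / s)) =
        1 / 16 * (((S *ᵥ y) ⬝ᵥ (S *ᵥ y)) / s ^ 2) := by
      rw [dotProduct, dotProduct, Finset.sum_div, Finset.mul_sum]
      refine Finset.sum_congr rfl fun b _ => ?_
      rw [← sq, mul_pow, div_pow, div_pow, he, sq_abs]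
      ring
    rw [h1]
    refine mul_le_mul_of_nonneg_left (div_le_of_le_mul₀ (sq_nonneg s) hy0 ?_) (by norm_num)
    rwa [mul_comm]
  have f2 : ((fun k => e / 8 * |y k|) ⬝ᵥ fun k => e / 8 * |y k|) = 1 / 64 * (y ⬝ᵥ y) := by
    rw [dotProduct, dotProduct, Finset.mul_sum]
    refine Finset.sum_congr rfl fun b _ => ?_
    rw [← sq, mul_pow, div_pow, he, sq_abs]
    ring
  have f3 : (fun b => e / 4 * |z b|) ⬝ᵥ (P₂⁻¹ *ᵥ fun b => e / 4 * |z b|) =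
      1 / 16 * (z ⬝ᵥ (P₂⁻¹ *ᵥ z)) :=
    dotProduct_inv_mulVec_of_sq_eq hP₂ fun k => by rw [mul_pow, div_pow, he, sq_abs]; ring
  have f4 : ((fun k => t / 4 * σ k) ⬝ᵥ fun k => t / 4 * σ k) ≤ 1 / 16 * (z ⬝ᵥ z) := by
    -- The `m` unit signs and `z1² ≤ p |z|²` together give the factor `p m = N²`, which the
    -- denominator of `t` cancels.
    have h1 : ((fun k => t / 4 * σ k) ⬝ᵥ fun k => t / 4 * σ k) = 1 / 16 * (m * z1 ^ 2 / N ^ 2) := by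
      calc _ = ∑ _k : Fin m, t ^ 2 / 16 :=
            Finset.sum_congr rfl fun k _ => by
              rw [← sq, mul_pow, hσ]
              ring
        _ = _ := by
          rw [Finset.sum_const, Finset.card_univ, Fintype.card_fin, nsmul_eq_mul, ht]
          ring
    rw [h1]
    refine mul_le_mul_of_nonneg_left (div_le_of_le_mul₀ (sq_nonneg N) hz0 ?_) (by norm_num)
    rw [hN2]
    calc (m : ℝ) * z1 ^ 2 ≤ m * (p * (z ⬝ᵥ z)) := by gcongr
      _ = _ := by ring
  have g : θ * (q1 * y1) ≤ N * θ * s * (y ⬝ᵥ y) := by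
    have h1 : q1 * y1 ≤ N * (s * (y ⬝ᵥ y)) := by
      refine (sq_le_sq₀ (by positivity) (by positivity)).1 ?_
      calc (q1 * y1) ^ 2 = q1 ^ 2 * y1 ^ 2 := mul_pow _ _ _
        _ ≤ (p * (s ^ 2 * (y ⬝ᵥ y))) * (m * (y ⬝ᵥ y)) :=
          mul_le_mul (hSy1.trans (by gcongr)) hy1 (sq_nonneg _) (by positivity)
        _ = N ^ 2 * (s * (y ⬝ᵥ y)) ^ 2 := by rw [hN2]; ring
        _ = _ := (mul_pow _ _ _).symm
    have h2 : θ * (q1 * y1) ≤ θ * (N * (s * (y ⬝ᵥ y))) := by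
      rcases Nat.eq_zero_or_pos p with h0 | hp
      · subst h0
        simp [hq1_def, hN]
      rcases Nat.eq_zero_or_pos m with h0 | hm
      · subst h0
        simp [hy1_def, hN]
      exact mul_le_mul_of_nonneg_left h1 (hθ hp hm)
    linarith
  have k1 := mul_le_mul_of_nonneg_left f1 (minDiagInv_nonneg hP₁)
  have k4 := mul_le_mul_of_nonneg_left f4 (minDiagInv_nonneg hP₃)
  have kg := mul_le_mul_of_nonneg_left g (mul_nonneg (Nat.cast_nonneg n) hc)
  have m1 := minDiagInv_mul_le hP₁ y
  have m2 := minDiagInv_mul_le hP₂ z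
  have m3 := minDiagInv_mul_le hP₃ z
  have n1 := mul_nonneg (minDiagInv_nonneg hP₁) hy0
  have n2 := mul_nonneg (minDiagInv_nonneg hP₂) hz0
  have n3 := mul_nonneg (minDiagInv_nonneg hP₃) hz0
  have nf : 0 ≤ n * c * (a ^ 2 * (l * β)) := by positivity
  rw [f2, f3] at h
  -- Net multiples left over: at least 5/16 of the `Π₁⁻¹` form, 3/8 of the `Π₂⁻¹` form, 3/8 of the
  -- `Π₃⁻¹` form, and half of the `f` term. All are nonnegative and are dropped.
  have h' : qM + (a ^ 2 * (n / 2 * l * β * c)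
      + 1 / 2 * (y ⬝ᵥ (P₁⁻¹ *ᵥ y)) + 1 / 2 * (s * n * N * θ * c) * (y ⬝ᵥ y)
      + 1 / 2 * (z ⬝ᵥ (P₂⁻¹ *ᵥ z)) + 1 / 2 * (z ⬝ᵥ (P₃⁻¹ *ᵥ z))
      + 2 * (n * c) * (|a| / 4 * ∑ b, ρ b * |(S *ᵥ y) b|)
      + 2 * l * (n * c) * (|a| / 8 * ∑ k, μ k * |y k|)
      + 2 * (n * c) * (|a| / 4 * ∑ b, ρ b * |z b|) + 2 * (n * θ * c) * (z1 * y1 / 4)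
      - 2 * (minDiagInv P₁ * (1 / 16 * (y ⬝ᵥ y))) - 4 * minDiagInv P₁ * (1 / 64 * (y ⬝ᵥ y))
      - 2 * (1 / 16 * (z ⬝ᵥ (P₂⁻¹ *ᵥ z))) - 2 * (minDiagInv P₃ * (1 / 16 * (z ⬝ᵥ z)))) ≤ 0 := by
    rw [← e1, ← e2, ← e3, ← e4]
    linarith
  unfold errorBound
  rw [← hy1_def, ← hz1_def, ← hq1_def]
  linarith

/-! ### Interpolation error of a C² function -/

/-- Entrywise bounds give `b (∑ |w_q|)²`; Cauchy–Schwarz then costs the factor `n`. -/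
theorem abs_fderivWithin_fderivWithin_le {X K : Set (E n)} {φ : E n → ℝ} {b : ℝ}
    (hX : UniqueDiffOn ℝ X) (hKX : K ⊆ X) (hb : HessianBound X K φ b) {ξ : E n} (hξ : ξ ∈ K)
    (w : E n) : |fderivWithin ℝ (fderivWithin ℝ φ X) X ξ w w| ≤ n * b * ‖w‖ ^ 2 := by
  set A := fderivWithin ℝ (fderivWithin ℝ φ X) X ξ
  have hA : ∀ q r, |A (EuclideanSpace.single q 1) (EuclideanSpace.single r 1)| ≤ b := fun q r => by
    have := hb q r ξ hξ
    rwa [secondPartial, iteratedFDerivWithin_two_apply φ hX (hKX hξ)] at this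
  rcases Nat.eq_zero_or_pos n with rfl | hn
  · rw [Subsingleton.elim w 0]
    simp
  have hb0 : 0 ≤ b := (abs_nonneg _).trans (hA ⟨0, hn⟩ ⟨0, hn⟩)
  have hw : w = ∑ q, w q • EuclideanSpace.single q (1 : ℝ) := by
    ext k
    simp [Pi.single_apply]
  have h1 : A w w = ∑ q, ∑ r, w q * w r *
      A (EuclideanSpace.single q 1) (EuclideanSpace.single r 1) := by
    conv_lhs => rw [hw]
    simp only [map_sum, map_smul, sum_apply, smul_apply,
      smul_eq_mul, Finset.mul_sum]
    rw [Finset.sum_comm]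
    exact Finset.sum_congr rfl fun _ _ => Finset.sum_congr rfl fun _ _ => by ring
  have h2 : (∑ q, |w q|) ^ 2 ≤ n * ‖w‖ ^ 2 := by
    have := sum_abs_sq_le_card_mul_dotProduct w.ofLp
    rw [Fintype.card_fin] at this
    rw [EuclideanSpace.real_norm_sq_eq]
    simpa [dotProduct, sq] using this
  calc |A w w| ≤ ∑ q, ∑ r, |w q| * |w r| * b := by
        rw [h1]
        refine (Finset.abs_sum_le_sum_abs _ _).trans (Finset.sum_le_sum fun q _ => ?_)
        refine (Finset.abs_sum_le_sum_abs _ _).trans (Finset.sum_le_sum fun r _ => ?_)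
        rw [abs_mul, abs_mul]
        exact mul_le_mul_of_nonneg_left (hA q r) (by positivity)
    _ = (∑ q, |w q|) ^ 2 * b := by
        rw [sq, Finset.sum_mul_sum, Finset.sum_mul]
        exact Finset.sum_congr rfl fun _ _ => (Finset.sum_mul _ _ _).symm
    _ ≤ n * ‖w‖ ^ 2 * b := mul_le_mul_of_nonneg_right h2 hb0
    _ = _ := by ring

/-- Along a segment with direction `w`, the quadratic term contributes `n b ‖w‖²` to the second
derivative, which compensates the most negative value the Hessian of `φ` can take. -/
theorem convexOn_add_mul_norm_sq {X K : Set (E n)} {φ : E n → ℝ} {b : ℝ} (hX : UniqueDiffOn ℝ X)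
    (hφ : ContDiffOn ℝ 2 φ X) (hKX : K ⊆ X) (hK : Convex ℝ K) (hb : HessianBound X K φ b) :
    ConvexOn ℝ K fun x => φ x + n * b / 2 * ‖x‖ ^ 2 := by
  refine ⟨hK, fun x hx y hy s t hs ht hst => ?_⟩
  set w := y - x with hw
  have hmem : ∀ r ∈ Set.Icc (0 : ℝ) 1, x + r • w ∈ K := fun r hr =>
    hK.add_smul_sub_mem hx hy hr
  have hmaps : Set.MapsTo (fun r : ℝ => x + r • w) (Set.Icc 0 1) X := fun r hr => hKX (hmem r hr)
  have hline : ∀ r : ℝ, HasDerivWithinAt (fun r : ℝ => x + r • w) w (Set.Icc 0 1) r := fun r => by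
    simpa using (((hasDerivAt_id r).smul_const w).const_add x).hasDerivWithinAt
  have hsub : interior (Set.Icc (0 : ℝ) 1) ⊆ Set.Icc 0 1 := interior_subset
  have hD1 : DifferentiableOn ℝ φ X := hφ.differentiableOn (by norm_num)
  have hD2 : DifferentiableOn ℝ (fderivWithin ℝ φ X) X :=
    (hφ.fderivWithin hX (m := 1) (by norm_num)).differentiableOn (by norm_num)
  have hd1 : ∀ r ∈ Set.Icc (0 : ℝ) 1, HasDerivWithinAt (fun r : ℝ => φ (x + r • w))
      (fderivWithin ℝ φ X (x + r • w) w) (Set.Icc 0 1) r := fun r hr =>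
    (hD1 _ (hmaps hr)).hasFDerivWithinAt.comp_hasDerivWithinAt r (hline r) hmaps
  have hd2 : ∀ r ∈ Set.Icc (0 : ℝ) 1, HasDerivWithinAt
      (fun r : ℝ => fderivWithin ℝ φ X (x + r • w) w)
      (fderivWithin ℝ (fderivWithin ℝ φ X) X (x + r • w) w w) (Set.Icc 0 1) r := fun r hr => by
    have h : HasDerivWithinAt (fun r : ℝ => fderivWithin ℝ φ X (x + r • w))
        (fderivWithin ℝ (fderivWithin ℝ φ X) X (x + r • w) w) (Set.Icc 0 1) r :=
      (hD2 _ (hmaps hr)).hasFDerivWithinAt.comp_hasDerivWithinAt r (hline r) hmaps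
    exact (ContinuousLinearMap.apply ℝ ℝ w).hasFDerivAt.comp_hasDerivWithinAt r h
  have hnorm : ∀ r : ℝ, ‖x + r • w‖ ^ 2 = ‖x‖ ^ 2 + 2 * r * inner ℝ x w + r ^ 2 * ‖w‖ ^ 2 :=
    fun r => by
      rw [norm_add_sq_real, inner_smul_right, norm_smul, mul_pow, Real.norm_eq_abs, sq_abs]
      ring
  set B : ℝ := n * b / 2 with hB
  have hq1 : ∀ r : ℝ, HasDerivAt (fun r : ℝ => B * ‖x + r • w‖ ^ 2)
      (B * (2 * inner ℝ x w + 2 * r * ‖w‖ ^ 2)) r := fun r => by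
    simp_rw [hnorm]
    have h1 : HasDerivAt (fun r : ℝ => ‖x‖ ^ 2 + 2 * r * inner ℝ x w + r ^ 2 * ‖w‖ ^ 2)
      (2 * inner ℝ x w + 2 * r * ‖w‖ ^ 2) r := by
      have h2 := (((hasDerivAt_id r).const_mul 2).mul_const (inner ℝ x w)).const_add (‖x‖ ^ 2)
      have h3 := ((hasDerivAt_id r).pow 2).mul_const (‖w‖ ^ 2)
      exact (h2.add h3).congr_deriv (by simp)
    exact h1.const_mul B
  have hq2 : ∀ r : ℝ, HasDerivAt (fun r : ℝ => B * (2 * inner ℝ x w + 2 * r * ‖w‖ ^ 2))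
      (B * (2 * ‖w‖ ^ 2)) r := fun r => by
    have h2 := (((((hasDerivAt_id r).const_mul 2).mul_const (‖w‖ ^ 2))).const_add
      (2 * inner ℝ x w)).const_mul B
    simpa using h2
  have hconv : ConvexOn ℝ (Set.Icc 0 1)
      fun r : ℝ => φ (x + r • w) + B * ‖x + r • w‖ ^ 2 :=
    convexOn_of_hasDerivWithinAt2_nonneg (convex_Icc 0 1)
      (fun r hr => (hd1 r hr).continuousWithinAt.add (hq1 r).continuousAt.continuousWithinAt)
      (fun r hr => ((hd1 r (hsub hr)).mono hsub).add (hq1 r).hasDerivWithinAt)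
      (fun r hr => ((hd2 r (hsub hr)).mono hsub).add (hq2 r).hasDerivWithinAt)
      (fun r hr => by
        have := neg_le_of_abs_le
          (abs_fderivWithin_fderivWithin_le hX hKX hb (hmem r (hsub hr)) w)
        rw [hB]
        linarith)
  have h := hconv.2 (Set.left_mem_Icc.2 zero_le_one) (Set.right_mem_Icc.2 zero_le_one) hs ht hst
  have hxy : x + t • (y - x) = s • x + t • y := by
    rw [eq_sub_of_add_eq hst]
    module
  simpa [hw, hxy] using h

theorem HessianBound.neg {X K : Set (E n)} {φ : E n → ℝ} {b : ℝ} (hX : UniqueDiffOn ℝ X)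
    (hKX : K ⊆ X) (hb : HessianBound X K φ b) : HessianBound X K (fun x => -φ x) b := by
  intro q r ξ hξ
  have h := hb q r ξ hξ
  have h1 : iteratedFDerivWithin ℝ 2 (fun x => -φ x) X ξ = -iteratedFDerivWithin ℝ 2 φ X ξ :=
    iteratedFDerivWithin_neg_apply hX (hKX hξ)
  rw [secondPartial] at h ⊢
  rwa [h1, neg_apply, abs_neg]

/-- Jensen's inequality for the convexified `φ` and `-φ` gives the two sides of the absolute value.
-/
theorem abs_sub_sum_le {X K : Set (E n)} {φ : E n → ℝ} {b : ℝ} (hX : UniqueDiffOn ℝ X)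
    (hφ : ContDiffOn ℝ 2 φ X) (hKX : K ⊆ X) (hK : Convex ℝ K) (hb : HessianBound X K φ b)
    {ι : Type*} [Fintype ι] {w : ι → ℝ} {x : ι → E n} (hw : ∀ j, 0 ≤ w j) (hw1 : ∑ j, w j = 1)
    (hx : ∀ j, x j ∈ K) :
    |φ (∑ j, w j • x j) - ∑ j, w j * φ (x j)| ≤
      n * b / 2 * (∑ j, w j * ‖x j‖ ^ 2 - ‖∑ j, w j • x j‖ ^ 2) := by
  have h1 := (convexOn_add_mul_norm_sq hX hφ hKX hK hb).map_sum_le (fun j _ => hw j) hw1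
    (fun j _ => hx j)
  have h2 := (convexOn_add_mul_norm_sq hX hφ.neg hKX hK (hb.neg hX hKX)).map_sum_le
    (fun j _ => hw j) hw1 (fun j _ => hx j)
  simp only [smul_eq_mul, mul_add, Finset.sum_add_distrib, mul_neg, Finset.sum_neg_distrib] at h1 h2
  have h3 : ∑ j, w j * (n * b / 2 * ‖x j‖ ^ 2) = n * b / 2 * ∑ j, w j * ‖x j‖ ^ 2 := by
    rw [Finset.mul_sum]
    exact Finset.sum_congr rfl fun _ _ => by ring
  rw [h3] at h1 h2
  rw [abs_le, mul_sub]
  constructor <;> linarith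

theorem sum_mul_sum_mul_norm_sub_sq {ι : Type*} [Fintype ι] {w : ι → ℝ} (x : ι → E n)
    (hw1 : ∑ j, w j = 1) :
    ∑ j, w j * ∑ k, w k * ‖x j - x k‖ ^ 2 =
      2 * (∑ j, w j * ‖x j‖ ^ 2 - ‖∑ j, w j • x j‖ ^ 2) := by
  have h1 : ∀ j, ∑ k, w k * ‖x j - x k‖ ^ 2 =
      ‖x j‖ ^ 2 - 2 * inner ℝ (x j) (∑ k, w k • x k) + ∑ k, w k * ‖x k‖ ^ 2 := fun j => by
    simp only [norm_sub_sq_real, mul_add, mul_sub, Finset.sum_add_distrib, Finset.sum_sub_distrib,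
      ← Finset.sum_mul, hw1, one_mul, inner_sum, inner_smul_right, Finset.mul_sum]
    congr 2
    exact Finset.sum_congr rfl fun _ _ => by ring
  have h2 : ∑ j, w j * inner ℝ (x j) (∑ k, w k • x k) = ‖∑ k, w k • x k‖ ^ 2 := by
    rw [← real_inner_self_eq_norm_sq, sum_inner]
    exact Finset.sum_congr rfl fun _ _ => by rw [real_inner_smul_left]
  simp only [h1, mul_add, mul_sub, Finset.sum_add_distrib, Finset.sum_sub_distrib, ← Finset.sum_mul,
    hw1, one_mul]
  have h3 : ∑ j, w j * (2 * inner ℝ (x j) (∑ k, w k • x k)) = 2 * ‖∑ k, w k • x k‖ ^ 2 := by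
    rw [← h2, Finset.mul_sum]
    exact Finset.sum_congr rfl fun _ _ => by ring
  rw [h3]
  ring

/-! ### Geometry of the simplices and the constants `c_{i,j}` -/

namespace Triangulation

variable {X : Set (E n)} (T : Triangulation X)

theorem c_nonneg (i : Fin T.N) (j : Fin (n + 1)) : 0 ≤ T.c i j := by
  unfold c
  split_ifs
  · have : 0 ≤ ⨆ k : Fin n, ‖T.vertex i k.succ - T.vertex i 0‖ :=
      Real.iSup_nonneg fun _ => norm_nonneg _
    positivity
  · exact Real.iSup_nonneg fun _ => by positivity

/-- If `0 ∈ σ_i`, then `x_{i,0} = 0` and `2‖x_{i,j}‖² ≤ c_{i,j}`, so the subtracted square can be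
discarded. Otherwise the variance is half the weighted mean of the squared pairwise distances, each
at most `c_{i,j}`. -/
theorem sum_mul_norm_sq_sub_le_sum_mul_c (i : Fin T.N) {w : Fin (n + 1) → ℝ} (hw : ∀ j, 0 ≤ w j)
    (hw1 : ∑ j, w j = 1) :
    ∑ j, w j * ‖T.vertex i j‖ ^ 2 - ‖∑ j, w j • T.vertex i j‖ ^ 2 ≤
      1 / 2 * ∑ j, w j * T.c i j := by
  by_cases h0 : (0 : E n) ∈ T.cell i
  · have hv : T.vertex i 0 = 0 := T.origin i h0
    have h1 : ∀ j, ‖T.vertex i j‖ ^ 2 ≤ 1 / 2 * T.c i j := fun j => by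
      rw [c, if_pos h0, hv, sub_zero]
      simp only [sub_zero]
      have h2 : ‖T.vertex i j‖ * ‖T.vertex i j‖ ≤
          ‖T.vertex i j‖ * ⨆ k : Fin n, ‖T.vertex i k.succ‖ := by
        refine Fin.cases ?_ (fun k => ?_) j
        · simp [hv]
        · exact mul_le_mul_of_nonneg_left
            (le_ciSup (f := fun k : Fin n => ‖T.vertex i k.succ‖) (Set.finite_range _).bddAbove k)
            (norm_nonneg _)
      linarith
    have h3 : ∑ j, w j * ‖T.vertex i j‖ ^ 2 ≤ 1 / 2 * ∑ j, w j * T.c i j := by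
      rw [Finset.mul_sum]
      refine Finset.sum_le_sum fun j _ => ?_
      have := mul_le_mul_of_nonneg_left (h1 j) (hw j)
      linarith
    linarith [sq_nonneg ‖∑ j, w j • T.vertex i j‖]
  · have h1 : ∀ j, ∑ k, w k * ‖T.vertex i j - T.vertex i k‖ ^ 2 ≤ T.c i j := fun j => by
      rw [c, if_neg h0]
      set C := ⨆ ν : Fin (n + 1), ‖T.vertex i j - T.vertex i ν‖ ^ 2
      calc _ ≤ ∑ k, w k * C := Finset.sum_le_sum fun k _ => mul_le_mul_of_nonneg_left
              (le_ciSup (f := fun ν => ‖T.vertex i j - T.vertex i ν‖ ^ 2)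
                (Set.finite_range _).bddAbove k) (hw k)
        _ = C := by rw [← Finset.sum_mul, hw1, one_mul]
    have h2 := sum_mul_sum_mul_norm_sub_sq (T.vertex i) hw1
    have h3 := Finset.sum_le_sum fun j (_ : j ∈ Finset.univ) =>
      mul_le_mul_of_nonneg_left (h1 j) (hw j)
    linarith

theorem convex_cell (i : Fin T.N) : Convex ℝ (T.cell i) := convex_convexHull ℝ _

theorem vertex_mem_cell (i : Fin T.N) (j : Fin (n + 1)) : T.vertex i j ∈ T.cell i :=
  subset_convexHull ℝ _ (Set.mem_range_self j)

theorem cell_subset (i : Fin T.N) : T.cell i ⊆ X := by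
  conv_rhs => rw [← T.iUnion_eq]
  exact Set.subset_iUnion (fun i => convexHull ℝ (Set.range (T.simplex i).points)) i

theorem exists_mem_cell {x : E n} (hx : x ∈ X) : ∃ i, x ∈ T.cell i := by
  rw [← T.iUnion_eq] at hx
  exact Set.mem_iUnion.1 hx

theorem exists_weights {i : Fin T.N} {x : E n} (hx : x ∈ T.cell i) :
    ∃ w : Fin (n + 1) → ℝ, (∀ j, 0 ≤ w j) ∧ ∑ j, w j = 1 ∧ ∑ j, w j • T.vertex i j = x := by
  have h : x ∈ (T.simplex i).closedInterior := by
    rwa [← Affine.Simplex.convexHull_eq_closedInterior]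
  obtain ⟨w, hw1, hw, rfl⟩ := h
  exact ⟨w, fun j => (hw j).1, hw1,
    (Finset.univ.affineCombination_eq_linear_combination _ _ hw1).symm⟩

theorem interior_cell_nonempty (i : Fin T.N) : (interior (T.cell i)).Nonempty := by
  refine interior_convexHull_nonempty_iff_affineSpan_eq_top.2 ?_
  exact (T.simplex i).independent.affineSpan_eq_top_iff_card_eq_finrank_add_one.2 (by simp)

theorem uniqueDiffWithinAt_cell {i : Fin T.N} {x : E n} (hx : x ∈ T.cell i) :
    UniqueDiffWithinAt ℝ (T.cell i) x :=
  uniqueDiffWithinAt_convex (T.convex_cell i) (T.interior_cell_nonempty i) (subset_closure hx)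

/-- Each point lies in a full-dimensional convex cell inside `X`, so derivatives within `X` are well
determined up to the boundary. -/
theorem uniqueDiffOn {X : Set (E n)} (T : Triangulation X) : UniqueDiffOn ℝ X := fun x hx => by
  obtain ⟨i, hi⟩ := T.exists_mem_cell hx
  exact (T.uniqueDiffWithinAt_cell hi).mono (T.cell_subset i)

end Triangulation

/-! ### Interpolation error of the quadratic form -/

theorem abs_sum_mul_sub_sum_le {α ι κ : Type*} [Fintype ι] [Fintype κ] {w : ι → ℝ} {x : α}
    {v : ι → α} {φ : κ → α → ℝ} {B : κ → ℝ} (a : κ → ℝ)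
    (h : ∀ k, |φ k x - ∑ j, w j * φ k (v j)| ≤ B k) :
    |(∑ k, a k * φ k x) - ∑ j, w j * ∑ k, a k * φ k (v j)| ≤ ∑ k, |a k| * B k := by
  have h1 : (∑ k, a k * φ k x) - ∑ j, w j * ∑ k, a k * φ k (v j) =
      ∑ k, a k * (φ k x - ∑ j, w j * φ k (v j)) := by
    simp only [mul_sub, Finset.sum_sub_distrib, Finset.mul_sum]
    rw [Finset.sum_comm]
    congr 1
    exact Finset.sum_congr rfl fun _ _ => Finset.sum_congr rfl fun _ _ => by ring
  rw [h1]
  refine (Finset.abs_sum_le_sum_abs _ _).trans (Finset.sum_le_sum fun k _ => ?_)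
  rw [abs_mul]
  exact mul_le_mul_of_nonneg_left (h k) (abs_nonneg _)

theorem dotProduct_mulVec_eq_sum_prod {ι κ : Type*} [Fintype ι] [Fintype κ] (u : ι → ℝ)
    (A : Matrix ι κ ℝ) (y : κ → ℝ) :
    u ⬝ᵥ (A *ᵥ y) = ∑ q : ι × κ, u q.1 * y q.2 * A q.1 q.2 := by
  rw [Fintype.sum_prod_type]
  simp only [dotProduct, Matrix.mulVec, Finset.mul_sum]
  exact Finset.sum_congr rfl fun _ _ => Finset.sum_congr rfl fun _ _ => by ring

/-- Only the terms in `f, G, h, J` incur an error; those in `R` and `Q⁻¹` are constant and survive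
averaging. The bounds `β` and `μ k` are uniform over state components, so they pair with the ℓ¹ norm
of `v`. -/
theorem qsrMatrix_quadForm_le (sys : ControlAffineSystem n m p) (hB : sys.B = 0) (hD : sys.D = 0)
    (Q : Matrix (Fin p) (Fin p) ℝ) (S : Matrix (Fin p) (Fin m) ℝ) (R : Matrix (Fin m) (Fin m) ℝ)
    (v : E n) {l β θ C : ℝ} {ρ : Fin p → ℝ} {μ : Fin m → ℝ} (hv : ∑ b, |v b| ≤ l)
    (hβ0 : 0 ≤ β) (hμ0 : ∀ k, 0 ≤ μ k) (hC : 0 ≤ C) {ι : Type*} [Fintype ι] {w : ι → ℝ} {x : E n}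
    {pt : ι → E n} (hw1 : ∑ j, w j = 1)
    (hf : ∀ b, |sys.f x b - ∑ j, w j * sys.f (pt j) b| ≤ n / 4 * β * C)
    (hh : ∀ b, |sys.h x b - ∑ j, w j * sys.h (pt j) b| ≤ n / 4 * ρ b * C)
    (hG : ∀ b k, |sys.G x b k - ∑ j, w j * sys.G (pt j) b k| ≤ n / 4 * μ k * C)
    (hJ : ∀ b k, |sys.J x b k - ∑ j, w j * sys.J (pt j) b k| ≤ n / 4 * θ * C)
    (a : ℝ) (y : Fin m → ℝ) (z : Fin p → ℝ) :
    (Sum.elim (fun _ => a) (Sum.elim y z)) ⬝ᵥ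
      (sys.qsrMatrix Q S R v x *ᵥ (Sum.elim (fun _ => a) (Sum.elim y z))) ≤
    ∑ j, w j * ((Sum.elim (fun _ => a) (Sum.elim y z)) ⬝ᵥ
      (sys.qsrMatrix Q S R v (pt j) *ᵥ (Sum.elim (fun _ => a) (Sum.elim y z)))) +
      C * errorBound n S l β θ ρ μ a y z := by
  simp only [qsrMatrix_quadForm sys hB hD]
  have tf : |v.ofLp ⬝ᵥ (sys.f x).ofLp - ∑ j, w j * (v.ofLp ⬝ᵥ (sys.f (pt j)).ofLp)| ≤
      n / 4 * C * (l * β) := by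
    refine (abs_sum_mul_sub_sum_le (φ := fun b t => sys.f t b) v.ofLp hf).trans ?_
    rw [← Finset.sum_mul]
    calc _ ≤ l * (n / 4 * β * C) := mul_le_mul_of_nonneg_right hv (by positivity)
      _ = _ := by ring
  have th (u : Fin p → ℝ) :
      |(sys.h x).ofLp ⬝ᵥ u - ∑ j, w j * ((sys.h (pt j)).ofLp ⬝ᵥ u)| ≤
        n / 4 * C * ∑ b, ρ b * |u b| := by
    simp only [dotProduct_comm _ u]
    refine (abs_sum_mul_sub_sum_le (φ := fun b t => sys.h t b) u hh).trans (le_of_eq ?_)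
    rw [Finset.mul_sum]
    exact Finset.sum_congr rfl fun _ _ => by ring
  have tG : |v.ofLp ⬝ᵥ (sys.G x *ᵥ y) - ∑ j, w j * (v.ofLp ⬝ᵥ (sys.G (pt j) *ᵥ y))| ≤
      n / 4 * C * (l * ∑ k, μ k * |y k|) := by
    simp only [dotProduct_mulVec_eq_sum_prod]
    refine (abs_sum_mul_sub_sum_le (φ := fun (q : Fin n × Fin m) t => sys.G t q.1 q.2)
      (fun q => v.ofLp q.1 * y q.2) fun q => hG q.1 q.2).trans ?_
    have h0 : 0 ≤ ∑ k, μ k * |y k| :=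
      Finset.sum_nonneg fun k _ => mul_nonneg (hμ0 k) (abs_nonneg _)
    calc _ = n / 4 * C * ((∑ b, |v b|) * ∑ k, μ k * |y k|) := by
          rw [Fintype.sum_prod_type, Finset.sum_mul_sum, Finset.mul_sum]
          refine Finset.sum_congr rfl fun _ _ => ?_
          rw [Finset.mul_sum]
          exact Finset.sum_congr rfl fun _ _ => by rw [abs_mul]; ring
      _ ≤ _ := mul_le_mul_of_nonneg_left (mul_le_mul_of_nonneg_right hv h0) (by positivity)
  have tJ (u : Fin p → ℝ) : |u ⬝ᵥ (sys.J x *ᵥ y) - ∑ j, w j * (u ⬝ᵥ (sys.J (pt j) *ᵥ y))| ≤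
      n / 4 * C * (θ * ((∑ b, |u b|) * ∑ k, |y k|)) := by
    simp only [dotProduct_mulVec_eq_sum_prod]
    refine (abs_sum_mul_sub_sum_le (φ := fun (q : Fin p × Fin m) t => sys.J t q.1 q.2)
      (fun q => u q.1 * y q.2) fun q => hJ q.1 q.2).trans (le_of_eq ?_)
    rw [Fintype.sum_prod_type, Finset.sum_mul_sum, Finset.mul_sum, Finset.mul_sum]
    refine Finset.sum_congr rfl fun _ _ => ?_
    rw [Finset.mul_sum, Finset.mul_sum]
    exact Finset.sum_congr rfl fun _ _ => by rw [abs_mul]; ring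
  have hsum (F₁ F₂ F₃ F₄ F₅ F₆ : ι → ℝ) (r q : ℝ) :
      ∑ j, w j * (a ^ 2 * F₁ j + a * F₂ j - 2 * a * F₃ j + 2 * a * F₄ j - r - 2 * F₅ j + 2 * F₆ j
        + q) = a ^ 2 * ∑ j, w j * F₁ j + a * ∑ j, w j * F₂ j - 2 * a * ∑ j, w j * F₃ j
        + 2 * a * ∑ j, w j * F₄ j - r - 2 * ∑ j, w j * F₅ j + 2 * ∑ j, w j * F₆ j + q := by
    have hr : r = ∑ j, w j * r := by rw [← Finset.sum_mul, hw1, one_mul]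
    have hq : q = ∑ j, w j * q := by rw [← Finset.sum_mul, hw1, one_mul]
    conv_rhs => rw [hr, hq]
    simp only [Finset.mul_sum, ← Finset.sum_add_distrib, ← Finset.sum_sub_distrib]
    exact Finset.sum_congr rfl fun _ _ => by ring
  rw [hsum]
  have scale {d b : ℝ} (t : ℝ) (h : |d| ≤ b) : t * d ≤ |t| * b :=
    (le_abs_self _).trans ((abs_mul t d).trans_le (mul_le_mul_of_nonneg_left h (abs_nonneg t)))
  have b1 := scale (a ^ 2) tf
  have b2 := scale a tG
  have b3 := scale (-(2 * a)) (th (S *ᵥ y))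
  have b4 := scale (2 * a) (th z)
  have b5 := scale (-2) (tJ (S *ᵥ y))
  have b6 := scale 2 (tJ z)
  rw [abs_neg] at b3 b5
  rw [abs_mul, abs_two] at b3 b4
  rw [abs_two] at b5 b6
  rw [abs_of_nonneg (sq_nonneg a)] at b1
  unfold errorBound
  linarith

theorem negSemidef_of_quadForm_nonpos {M : Matrix (Unit ⊕ Fin m ⊕ Fin p) (Unit ⊕ Fin m ⊕ Fin p) ℝ}
    (hM : M.IsSymm) (h : ∀ (a : ℝ) (y : Fin m → ℝ) (z : Fin p → ℝ),
      (Sum.elim (fun _ => a) (Sum.elim y z)) ⬝ᵥ (M *ᵥ (Sum.elim (fun _ => a) (Sum.elim y z))) ≤ 0) :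
    NegSemidef M := by
  refine Matrix.PosSemidef.of_dotProduct_mulVec_nonneg ?_ fun u => ?_
  · rw [Matrix.IsHermitian, Matrix.conjTranspose_eq_transpose_of_trivial, Matrix.transpose_neg,
      hM.eq]
  · have hu : u = Sum.elim (fun _ => u (Sum.inl ())) (Sum.elim (fun k => u (Sum.inr (Sum.inl k)))
        fun b => u (Sum.inr (Sum.inr b))) := by
      ext i
      rcases i with _ | _ | _ <;> rfl
    rw [star_trivial, Matrix.neg_mulVec, dotProduct_neg, hu]
    exact neg_nonneg.2 (h _ _ _)

theorem qsrMatrix_quadForm_zero_nonpos (sys : ControlAffineSystem n m p) (hB : sys.B = 0)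
    (hD : sys.D = 0) {Q : Matrix (Fin p) (Fin p) ℝ} (S : Matrix (Fin p) (Fin m) ℝ)
    {R : Matrix (Fin m) (Fin m) ℝ} (hQ : NegDef Q) (hR : R.PosDef) (v : E n) (a : ℝ)
    (y : Fin m → ℝ) (z : Fin p → ℝ) :
    (Sum.elim (fun _ => a) (Sum.elim y z)) ⬝ᵥ
      (sys.qsrMatrix Q S R v 0 *ᵥ (Sum.elim (fun _ => a) (Sum.elim y z))) ≤ 0 := by
  rw [qsrMatrix_quadForm sys hB hD, sys.f_zero, sys.G_zero, sys.h_zero, sys.J_zero]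
  have h1 := hR.posSemidef.dotProduct_mulVec_nonneg y
  have h2 := (Matrix.PosDef.inv hQ).posSemidef.dotProduct_mulVec_nonneg z
  have h3 : (-Q)⁻¹ = -Q⁻¹ := by
    refine Matrix.inv_eq_left_inv ?_
    have := (Matrix.isUnit_iff_isUnit_det _).1 (Matrix.PosDef.isUnit hQ).neg
    rw [neg_neg] at this
    rw [neg_mul_neg, Matrix.nonsing_inv_mul _ this]
  rw [h3, star_trivial, Matrix.neg_mulVec, dotProduct_neg] at h2
  rw [star_trivial] at h1
  simp only [WithLp.ofLp_zero, dotProduct_zero, Matrix.zero_mulVec, zero_dotProduct]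
  linarith

/-! ### Errors on a cell and the gradient of the CPA function -/

namespace Triangulation

variable {X : Set (E n)} (T : Triangulation X)

theorem abs_sub_sum_mul_vertex_le {φ : E n → ℝ} {b : ℝ} (hφ : ContDiffOn ℝ 2 φ X) {i : Fin T.N}
    (hb : HessianBound X (T.cell i) φ b) (hb0 : 0 ≤ b) {w : Fin (n + 1) → ℝ} (hw : ∀ j, 0 ≤ w j)
    (hw1 : ∑ j, w j = 1) :
    |φ (∑ j, w j • T.vertex i j) - ∑ j, w j * φ (T.vertex i j)| ≤
      n / 4 * b * ∑ j, w j * T.c i j := by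
  refine (abs_sub_sum_le T.uniqueDiffOn hφ (T.cell_subset i) (T.convex_cell i) hb hw hw1
    (T.vertex_mem_cell i)).trans ?_
  have := mul_le_mul_of_nonneg_left (T.sum_mul_norm_sq_sub_le_sum_mul_c i hw hw1)
    (show 0 ≤ n * b / 2 by positivity)
  linarith

/-- Even at a boundary point of the cell, the derivative within it is unique, so it is the linear
part of the affine piece. Pairing with the edges gives the system defining `grad`, whose matrix is
invertible by affine independence. -/
theorem gradient_eq_grad {V : E n → ℝ} (hV : T.IsCPA V) {i : Fin T.N} {x : E n}
    (hx : x ∈ T.cell i) (hd : DifferentiableAt ℝ V x) : gradient V x = T.grad V i := by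
  obtain ⟨g, hg⟩ := hV.2 i
  have h1 : HasFDerivWithinAt V g.linear.toContinuousLinearMap (T.cell i) x := by
    have h : HasFDerivWithinAt g g.linear.toContinuousLinearMap (T.cell i) x := by
      have h2 : ⇑g = fun t => g.linear.toContinuousLinearMap t + g 0 := by
        ext t
        simpa using congrFun g.decomp t
      rw [h2]
      exact (g.linear.toContinuousLinearMap.hasFDerivAt.add_const _).hasFDerivWithinAt
    exact h.congr hg (hg hx)
  have h2 := (T.uniqueDiffWithinAt_cell hx).eq hd.hasFDerivAt.hasFDerivWithinAt h1
  set A : Matrix (Fin n) (Fin n) ℝ :=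
    Matrix.of fun j k : Fin n => T.vertex i j.succ k - T.vertex i 0 k with hA
  have h3 : A *ᵥ (gradient V x).ofLp = fun j => V (T.vertex i j.succ) - V (T.vertex i 0) := by
    ext j
    have h4 : inner ℝ (gradient V x) (T.vertex i j.succ - T.vertex i 0) =
        V (T.vertex i j.succ) - V (T.vertex i 0) := by
      rw [inner_gradient_left, h2, hg (T.vertex_mem_cell i _), hg (T.vertex_mem_cell i _)]
      exact g.linearMap_vsub _ _
    rw [← h4, PiLp.inner_apply]
    simp [Matrix.mulVec, dotProduct, hA]
  have hunit : IsUnit A := by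
    rw [← Matrix.linearIndependent_rows_iff_isUnit]
    have h5 := (affineIndependent_iff_linearIndependent_vsub ℝ _ 0).1 (T.simplex i).independent
    have h6 := h5.comp (fun j : Fin n => ⟨j.succ, Fin.succ_ne_zero j⟩)
      fun j k h => Fin.succ_injective _ (congrArg Subtype.val h)
    exact h6.map' (WithLp.linearEquiv 2 ℝ (Fin n → ℝ)).toLinearMap (LinearEquiv.ker _)
  rw [grad, ← hA, ← h3, Matrix.mulVec_mulVec,
    Matrix.nonsing_inv_mul _ ((Matrix.isUnit_iff_isUnit_det _).1 hunit), Matrix.one_mulVec]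

end Triangulation

end QSRDissipativity

end

open QSRDissipativity in
theorem mainTheorem1 {n m p : ℕ}
    -- the system, with `B = 0` and `D = 0`, of class `C²` on the region `X`
    (sys : ControlAffineSystem n m p) (hB : sys.B = 0) (hD : sys.D = 0)
    (X : Set (E n)) (hX : IsRegion X) (hC2 : sys.IsC2On X)
    -- the supply rate
    (Q : Matrix (Fin p) (Fin p) ℝ) (S : Matrix (Fin p) (Fin m) ℝ) (R : Matrix (Fin m) (Fin m) ℝ)
    (hQ : NegDef Q) (hR : R.PosDef)
    -- the scaling matrices
    (P₁ : Matrix (Fin m) (Fin m) ℝ) (P₂ P₃ : Matrix (Fin p) (Fin p) ℝ)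
    (hP₁ : P₁.IsDiag ∧ P₁.PosDef) (hP₂ : P₂.IsDiag ∧ P₂.PosDef) (hP₃ : P₃.IsDiag ∧ P₃.PosDef)
    -- the triangulation, the CPA function and the scalars
    (T : Triangulation X) (V : E n → ℝ) (hV : T.IsCPA V)
    (l : Fin T.N → ℝ) (s : ℝ)
    -- the Hessian bounds
    (β θ : Fin T.N → ℝ) (ρ : Fin T.N → Fin p → ℝ) (μ : Fin T.N → Fin m → ℝ)
    (hβ : ∀ i a, HessianBound X (T.cell i) (fun x => sys.f x a) (β i))
    (hρ : ∀ i a, HessianBound X (T.cell i) (fun x => sys.h x a) (ρ i a))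
    (hμ : ∀ i k a, HessianBound X (T.cell i) (fun x => sys.G x a k) (μ i k))
    (hθ : ∀ i k a, HessianBound X (T.cell i) (fun x => sys.J x a k) (θ i))
    -- the vertex constraints
    (hpos : ∀ i j, 0 ≤ V (T.vertex i j))
    (hl : ∀ i, ∑ k, |T.grad V i k| ≤ l i)
    (hs : spectralNorm S ≤ s)
    (hLMI : ∀ i j, T.vertex i j ≠ 0 →
      NegSemidef (padZero (sys.qsrMatrix Q S R (T.grad V i) (T.vertex i j)) +
        errorMatrix n P₁ P₂ P₃ s (l i) (β i) (θ i) (ρ i) (μ i) (T.c i j))) :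
    ∀ x ∈ interior X,
      (∀ i, x ∈ T.cell i → NegSemidef (sys.qsrMatrix Q S R (T.grad V i) x)) ∧
      (DifferentiableAt ℝ V x → NegSemidef (sys.qsrMatrix Q S R (gradient V x) x)) := by
  have hQs : Q.IsSymm := by
    have h := hQ.isHermitian
    rwa [Matrix.IsHermitian, Matrix.conjTranspose_eq_transpose_of_trivial, Matrix.transpose_neg,
      neg_inj] at h
  have hRs : R.IsSymm := by
    have h := hR.isHermitian
    rwa [Matrix.IsHermitian, Matrix.conjTranspose_eq_transpose_of_trivial] at h
  have key : ∀ x, ∀ i, x ∈ T.cell i → NegSemidef (sys.qsrMatrix Q S R (T.grad V i) x) := by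
    intro x i hx
    refine negSemidef_of_quadForm_nonpos (qsrMatrix_isSymm sys S hQs hRs _ _) fun a y z => ?_
    -- In dimension zero the Hessian bounds are vacuous and give no signs, but the only point is the
    -- origin.
    rcases Nat.eq_zero_or_pos n with rfl | hn
    · rw [Subsingleton.elim x 0]
      exact qsrMatrix_quadForm_zero_nonpos sys hB hD S hQ hR _ a y z
    have nonneg {φ : E n → ℝ} {b : ℝ} (h : HessianBound X (T.cell i) φ b) : 0 ≤ b :=
      (abs_nonneg _).trans (h ⟨0, hn⟩ ⟨0, hn⟩ x hx)
    have hβ0 : 0 ≤ β i := nonneg (hβ i ⟨0, hn⟩)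
    have hρ0 : ∀ b, 0 ≤ ρ i b := fun b => nonneg (hρ i b)
    have hμ0 : ∀ k, 0 ≤ μ i k := fun k => nonneg (hμ i k ⟨0, hn⟩)
    have hl0 : 0 ≤ l i := (Finset.sum_nonneg fun _ _ => abs_nonneg _).trans (hl i)
    obtain ⟨w, hw, hw1, rfl⟩ := T.exists_weights hx
    have hC : 0 ≤ ∑ j, w j * T.c i j :=
      Finset.sum_nonneg fun j _ => mul_nonneg (hw j) (T.c_nonneg i j)
    refine (qsrMatrix_quadForm_le sys hB hD Q S R (T.grad V i) (hl i) hβ0 hμ0 hC hw1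
      (fun b => T.abs_sub_sum_mul_vertex_le (contDiffOn_euclidean.1 hC2.1 b) (hβ i b) hβ0 hw hw1)
      (fun b => T.abs_sub_sum_mul_vertex_le (contDiffOn_euclidean.1 hC2.2.2.1 b) (hρ i b) (hρ0 b)
        hw hw1)
      (fun b k => T.abs_sub_sum_mul_vertex_le (hC2.2.1 b k) (hμ i k b) (hμ0 k) hw hw1)
      (fun b k => T.abs_sub_sum_mul_vertex_le (hC2.2.2.2 b k) (hθ i k b) (nonneg (hθ i k b))
        hw hw1) a y z).trans ?_
    rw [Finset.sum_mul, ← Finset.sum_add_distrib]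
    refine Finset.sum_nonpos fun j _ => ?_
    rw [mul_assoc, ← mul_add]
    refine mul_nonpos_of_nonneg_of_nonpos (hw j) ?_
    -- No LMI is assumed at the origin; there `x_{i,j} = x_{i,0}`, so the error constant vanishes.
    by_cases hj : T.vertex i j = 0
    · have h0 : (0 : E n) ∈ T.cell i := hj ▸ T.vertex_mem_cell i j
      have hc : T.c i j = 0 := by
        have hv : T.vertex i 0 = 0 := T.origin i h0
        rw [Triangulation.c, if_pos h0, hj, hv, sub_zero, norm_zero, zero_mul]
      rw [hc, zero_mul, add_zero, hj]
      exact qsrMatrix_quadForm_zero_nonpos sys hB hD S hQ hR _ a y z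
    · exact quadForm_add_errorBound_nonpos _ hP₁ hP₂ hP₃ hs hl0 hβ0
        (fun hp hm => nonneg (hθ i ⟨0, hm⟩ ⟨0, hp⟩)) (T.c_nonneg i j) (hLMI i j hj) a y z
  refine fun x hx => ⟨key x, fun hd => ?_⟩
  obtain ⟨i, hi⟩ := T.exists_mem_cell (interior_subset hx)
  rw [T.gradient_eq_grad hV hi hd]
  exact key x i hi
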